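/- Let $\mathcal{A}$ be a finite alphabet and let $\sigma$ be a substitution over $\mathcal{A}$, i.e. an endomorphism of the free monoid $\mathcal{A}^*$ such that $\sigma(a)$ is non-empty for every letter $a$ and $|\sigma^k(a)|\to\infty$ for at least one letter $a$. Its incidence matrix $M_\sigma$ has entries $(M_\sigma)_{a,b}=|\sigma(b)|_a$, the number of occurrences of $a$ in $\sigma(b)$. Suppose that $\sigma$ is an irreducible Pisot substitution: $M_\sigma$ is primitive, its characteristic polynomial is irreducible over $\mathbb{Q}$, and its dominant eigenvalue $\alpha$ is a Pisot number (an algebraic integer $\alpha>1$ all of whose other conjugates have absolute value $<1$). Let $K=\mathbb{Q}(\alpha)$ and let $(v_a)_{a\in\mathcal{A}}$ be a left eigenvector of $M_\sigma$ for $\alpha$ with positive entries $v_a\in K$. Put $\delta(p)=\sum_{i} v_{p_i}$ for a word $p=p_1p_2\cdots\in\mathcal{A}^*$, and $V=\langle v_a: a\in\mathcal{A}\rangle_{\mathbb{Z}}$. *Representation space.* Let $\mathfrak{p}_1$ be the infinite prime of $K$ given by the inclusion $K\subset\mathbb{R}$, and let $K_\sigma=\prod_{\mathfrak{p}}K_{\mathfrak{p}}$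 be the product of the completions of $K$ over the infinite primes $\mathfrak{p}\neq\mathfrak{p}_1$ and the finite primes $\mathfrak{p}\mid(\alpha)$, with the product topology. Let $\Phi':K\to K_\sigma$ be the diagonal embedding and $\|\mathbf{z}\|=\max_{\mathfrak{p}}|z_{\mathfrak{p}}|_{\mathfrak{p}}$, where $|\cdot|_{\mathfrak{p}}$ is the normalised absolute value (the usual absolute value if $\mathfrak{p}$ is real, its square if $\mathfrak{p}$ is complex, $\mathfrak{N}(\mathfrak{p})^{-v_{\mathfrak{p}}(\cdot)}$ if $\mathfrak{p}$ is finite). *Subtiles.* Write $a\xrightarrow{p}b$ if $\sigma(a)=pbs$ for some word $s$. For $a\in\mathcal{A}$ and $k\ge 0$ let $$\mathbb{Z}_{\sigma,a}^{(k)}=\Big\{\sum_{i=0}^{k-1}\delta(p_i)\alpha^i \;:\; a_k\xrightarrow{p_{k-1}}\cdots\xrightarrow{p_1}a_1\xrightarrow{p_0}a\Big\}\subset K\subset\mathbb{R},$$ let $\mathbb{Z}_{\sigma,a}=\operatorname{Lim}_{k\to\infty}\mathbb{Z}_{\sigma,a}^{(k)}$ be the topological (Kuratowski) limit of these sets in $\mathbb{R}$,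 and let $\mathcal{R}_\sigma(a)=\overline{\Phi'(\mathbb{Z}_{\sigma,a})}\subset K_\sigma$. *Translation set.* Let $\Gamma=\{(\Phi'(x),a) : a\in\mathcal{A},\ x\in V\cdot\mathbb{Z}[\alpha^{-1}]\cap[0,\delta(a))\}\subset K_\sigma\times\mathcal{A}$. **Proposition.** The topological limits $\mathbb{Z}_{\sigma,a}$ exist and are contained in $K$ (so that the subtiles are well defined), and the sets $\mathcal{R}_\sigma(a)+\gamma$, $(\gamma,a)\in\Gamma$, form a uniformly locally finite covering of $K_\sigma$, that is: 1. for every $r$ there is an $m\in\mathbb{N}$ such that for every $\mathbf{c}\in K_\sigma$ the ball $\{\mathbf{z}\in K_\sigma:\|\mathbf{z}-\mathbf{c}\|\le r\}$ meets $\mathcal{R}_\sigma(a)+\gamma$ for at most $m$ pairs $(\gamma,a)\in\Gamma$; 2. $\displaystyle K_\sigma=\bigcup_{(\gamma,a)\in\Gamma}\mathcal{R}_\sigma(a)+\gamma .$ -/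

import Mathlib

open Filter Topology NumberField IsDedekindDomain

noncomputable section

/-! ### Substitutions -/

/-- The extension of a map `f : A → A*` to an endomorphism of the free monoid `A*` of finite words
over `A`. -/
def wordMap {A : Type*} (f : A → List A) (w : List A) : List A := w.flatMap f

/-- A substitution over the alphabet `A`, given by the images of the letters: an endomorphism of
the free monoid `A*` such that the image of each letter is non-empty and the lengths of the iterated
images of at least one letter tend to infinity. -/
structure Substitution (A : Type*) where
  /-- the image of a letter -/
  img : A → List A
  img_ne_nil : ∀ a, img a ≠ []
  exists_growing : ∃ a, Tendsto (fun k : ℕ => ((wordMap img)^[k] [a]).length) atTop atTop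

namespace Substitution

variable {A : Type*}

/-- The incidence matrix `M_σ`: the entry `(a, b)` is the number of occurrences of `a` in `σ(b)`. -/
def incidence [DecidableEq A] (σ : Substitution A) : Matrix A A ℕ :=
  fun a b => (σ.img b).count a

/-- The edge `a --p--> b` of the prefix automaton: `σ(a) = p b s` for some word `s`. -/
def PrefixEdge (σ : Substitution A) (a : A) (p : List A) (b : A) : Prop :=
  ∃ s : List A, σ.img a = p ++ b :: s

end Substitution

/-- A Pisot number: an algebraic integer `β > 1` all of whose other conjugates have absolute value
less than `1`. -/
def IsPisotNumber (β : ℝ) : Prop :=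
  IsIntegral ℤ β ∧ 1 < β ∧ ∀ z : ℂ, Polynomial.aeval z (minpoly ℚ β) = 0 → z ≠ (β : ℂ) → ‖z‖ < 1

/-- `β` is the dominant eigenvalue of the real matrix `M`: a real eigenvalue which is at least as
large as the absolute value of every complex eigenvalue. -/
def IsDominantEigenvalue {A : Type*} [Fintype A] [DecidableEq A] (M : Matrix A A ℝ) (β : ℝ) :
    Prop :=
  Module.End.HasEigenvalue (Matrix.toLin' M) β ∧
    ∀ z : ℂ, Module.End.HasEigenvalue (Matrix.toLin' (M.map (fun x : ℝ => (x : ℂ)))) z → ‖z‖ ≤ β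

/-- `σ` is an irreducible Pisot substitution with Pisot root `β`. -/
structure Substitution.IsIrreduciblePisot {A : Type*} [Fintype A] [DecidableEq A]
    (σ : Substitution A) (β : ℝ) : Prop where
  primitive : (σ.incidence.map (fun m : ℕ => (m : ℝ))).IsPrimitive
  irreducible : Irreducible (σ.incidence.map (fun m : ℕ => (m : ℚ))).charpoly
  dominant : IsDominantEigenvalue (σ.incidence.map (fun m : ℕ => (m : ℝ))) β
  pisot : IsPisotNumber β

/-! ### Topological (Kuratowski) limits of sequences of sets -/

/-- The lower topological limit. -/
def lowerTopLimit {Y : Type*} [TopologicalSpace Y] (S : ℕ → Set Y) : Set Y :=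
  {y | ∀ U ∈ 𝓝 y, ∀ᶠ k in atTop, (S k ∩ U).Nonempty}

/-- The upper topological limit. -/
def upperTopLimit {Y : Type*} [TopologicalSpace Y] (S : ℕ → Set Y) : Set Y :=
  {y | ∀ U ∈ 𝓝 y, ∃ᶠ k in atTop, (S k ∩ U).Nonempty}

/-- The topological limit of the sequence `S` exists and is equal to `L`. -/
def IsTopLimit {Y : Type*} [TopologicalSpace Y] (S : ℕ → Set Y) (L : Set Y) : Prop :=
  lowerTopLimit S = L ∧ upperTopLimit S = L

/-! ### Dumont-Thomas numeration

`K` is a number field with a real embedding `τ`, `α : K`, and `v : A → K` is a vector. In the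
theorem `K = ℚ(α)`, the Pisot root is the real number `τ α`, and `v` is a left eigenvector of the
incidence matrix. -/

section Numeration

variable {A K : Type*} [Field K]

/-- `δ(p) = ⟨P(p), v⟩`, the sum of the `v a` over the letters `a` of `p`. -/
def digit (v : A → K) (p : List A) : K := (p.map v).sum

/-- The set `ℤ_{σ,a}^{(k)}` of the sums `∑_{i<k} δ(p_i) α^i` over the walks
`c_k --p_{k-1}--> ⋯ --p_1--> c_1 --p_0--> c_0 = a` in the prefix automaton. -/
def approxIntegers (σ : Substitution A) (α : K) (v : A → K) (a : A) (k : ℕ) : Set K :=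
  {x | ∃ (c : ℕ → A) (p : ℕ → List A), c 0 = a ∧
    (∀ i < k, σ.PrefixEdge (c (i + 1)) (p i) (c i)) ∧
    x = ∑ i ∈ Finset.range k, digit v (p i) * α ^ i}

/-- The set `ℤ_{σ,a}` of `(σ,a)`-integers: the topological limit in `ℝ` of the sets
`ℤ_{σ,a}^{(k)}`, seen in `K` (see `IsTopLimit` for the existence of the limit). -/
def sigmaIntegers (τ : K →+* ℝ) (σ : Substitution A) (α : K) (v : A → K) (a : A) : Set K :=
  {x | τ x ∈ lowerTopLimit (fun k => τ '' approxIntegers σ α v a k)}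

/-- The set `V · ℤ[α⁻¹]`, where `V` is the `ℤ`-module generated by the entries of `v`. -/
def latticeModule (α : K) (v : A → K) : Submodule ℤ K :=
  Submodule.span ℤ (Set.range v) * Subalgebra.toSubmodule (Algebra.adjoin ℤ {α⁻¹})

/-- The set `Frac(σ,a) = V · ℤ[α⁻¹] ∩ [0, δ(a))` of `(σ,a)`-fractional parts. -/
def fracParts (τ : K →+* ℝ) (α : K) (v : A → K) (a : A) : Set K :=
  {x | x ∈ latticeModule α v ∧ τ x ∈ Set.Ico 0 (τ (v a))}

end Numeration

/-! ### The representation space and the subtiles -/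

section Tiles

variable {A K : Type*} [Field K] [NumberField K]

/-- The infinite prime `𝔭₁` given by the real embedding `τ`. -/
def mainPlace (τ : K →+* ℝ) : InfinitePlace K := InfinitePlace.mk (Complex.ofRealHom.comp τ)

/-- The representation space `K_σ`: the product of the completions of `K` at the infinite primes
other than `𝔭₁` and at the finite primes dividing `(α)`. -/
abbrev ReprSpace (τ : K →+* ℝ) (α : K) : Type _ :=
  ((w : {w : InfinitePlace K // w ≠ mainPlace τ}) → w.1.Completion) ×
    ((P : {P : HeightOneSpectrum (𝓞 K) // P.valuation K α < 1}) → P.1.adicCompletion K)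

/-- The diagonal embedding `Φ'` of `K` into `K_σ`. -/
def diagEmb (τ : K →+* ℝ) (α : K) (x : K) : ReprSpace τ α :=
  (fun w => algebraMap K w.1.Completion x, fun P => FinitePlace.embedding P.1 x)

/-- The closed ball `{z : ‖z - c‖ ≤ r}`, where `‖z‖` is the maximum of the normalised absolute
values `|z_𝔭|_𝔭`: the usual absolute value if `𝔭` is real, its square if `𝔭` is complex, and
`𝔑(𝔭) ^ (-v_𝔭)` if `𝔭` is finite. -/
def reprBall (τ : K →+* ℝ) (α : K) (c : ReprSpace τ α) (r : ℝ) : Set (ReprSpace τ α) :=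
  {z | (∀ w, ‖z.1 w - c.1 w‖ ^ w.1.mult ≤ r) ∧ ∀ P, ‖z.2 P - c.2 P‖ ≤ r}

/-- The Dumont-Thomas subtile `R_σ(a)`, the closure of `Φ'(ℤ_{σ,a})` in `K_σ`. -/
def subtile (τ : K →+* ℝ) (σ : Substitution A) (α : K) (v : A → K) (a : A) :
    Set (ReprSpace τ α) :=
  closure (diagEmb τ α '' sigmaIntegers τ σ α v a)

/-- The translation set `Γ = {(Φ'(x), a) : x ∈ Frac(σ,a)}`. -/
def translationSet (τ : K →+* ℝ) (α : K) (v : A → K) : Set (ReprSpace τ α × A) :=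
  {g | ∃ x ∈ fracParts τ α v g.2, g.1 = diagEmb τ α x}

/-- The translated subtile `R_σ(a) + γ`. -/
def translatedSubtile (τ : K →+* ℝ) (σ : Substitution A) (α : K) (v : A → K)
    (g : ReprSpace τ α × A) : Set (ReprSpace τ α) :=
  (fun z => z + g.1) '' subtile τ σ α v g.2

/-- The family `(T g)_{g ∈ G}` of subsets of `K_σ` is uniformly locally finite: for every radius
there is a uniform bound for the number of members of the family that meet a ball of this radius. -/
def UniformlyLocallyFinite (τ : K →+* ℝ) (α : K) {I : Type*} (G : Set I)
    (T : I → Set (ReprSpace τ α)) : Prop :=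
  ∀ r : ℝ, ∃ m : ℕ, ∀ c : ReprSpace τ α,
    {g | g ∈ G ∧ (T g ∩ reprBall τ α c r).Nonempty}.encard ≤ m

end Tiles

end

noncomputable section

/-! ### Walks in the prefix automaton and greedy expansions of real numbers -/

section Walks

variable {A K : Type*} [Field K] {τ : K →+* ℝ} {σ : Substitution A} {α : K} {v : A → K}

/-! Since `δ(σ(b)) = α δ(b)`, subdividing intervals according to `σ` expands every real `t ≥ 0`
greedily: `t` lies in some `[y, y + δ(a))` with `y` a `(σ,a)`-integer
(`exists_sigmaIntegers_le_lt`). A non-empty prefix in position `k` contributes at least a constant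
times `α^k`, so below such a height all later levels are contained in the finite set of level `k`;
this gives the topological limits.

In `K_σ` the element `α` is a contraction: at the infinite places because it is Pisot, at the finite
ones because they divide it. Hence the subtiles are bounded (`exists_norm_approxIntegers_le`), and
`V · ℤ[α⁻¹]` behaves like a lattice in `ℝ × K_σ`: it is discrete there
(`finite_latticeModule_inter`), while its non-negative elements are dense in `K_σ`
(`exists_latticeModule_norm_sub_lt`).

Discreteness bounds the number of translates that meet a ball, so the union of all translates is
closed. Writing a non-negative `x` of `V · ℤ[α⁻¹]` as `y + (x - y)` by the greedy expansion shows
that the union contains `Φ'(x)`. Being closed and dense, it is all of `K_σ`. -/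

theorem digit_nil (v : A → K) : digit v [] = 0 := rfl

theorem digit_cons (v : A → K) (a : A) (p : List A) : digit v (a :: p) = v a + digit v p := by
  simp [digit]

theorem map_digit_nonneg (hv : ∀ a, 0 < τ (v a)) (p : List A) : 0 ≤ τ (digit v p) := by
  induction p with
  | nil => simp [digit_nil]
  | cons a p ih => rw [digit_cons, map_add]; exact add_nonneg (hv a).le ih

theorem le_map_digit_of_ne_nil {δ : ℝ} (hδ : ∀ a, δ ≤ τ (v a)) (hv : ∀ a, 0 < τ (v a))
    {p : List A} (hp : p ≠ []) : δ ≤ τ (digit v p) := by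
  cases p with
  | nil => exact absurd rfl hp
  | cons a p =>
    rw [digit_cons, map_add]
    linarith [hδ a, map_digit_nonneg hv p]

theorem digit_mem_span (v : A → K) (p : List A) :
    digit v p ∈ Submodule.span ℤ (Set.range v) := by
  induction p with
  | nil => exact zero_mem _
  | cons a p ih => rw [digit_cons]; exact add_mem (Submodule.subset_span ⟨a, rfl⟩) ih

/-- The eigenvector equation says that `δ(σ(b)) = α δ(b)`. -/
theorem digit_img [Fintype A] [DecidableEq A]
    (hv : Matrix.vecMul v (σ.incidence.map (fun m : ℕ => (m : K))) = α • v) (b : A) :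
    digit v (σ.img b) = α * v b := by
  have h := congrFun hv b
  rw [Pi.smul_apply, smul_eq_mul] at h
  rw [← h, digit, Finset.sum_list_map_count, Matrix.vecMul, dotProduct]
  refine (Finset.sum_subset (Finset.subset_univ _) fun a _ ha => ?_).trans
    (Finset.sum_congr rfl fun a _ => ?_)
  · rw [List.count_eq_zero_of_not_mem (by simpa using ha), zero_smul]
  · rw [nsmul_eq_mul, mul_comm]
    rfl

/-- A real number in `[0, δ(w))` falls into the interval of a letter of `w`. -/
theorem exists_split_of_lt_digit {w : List A} {t : ℝ} (h0 : 0 ≤ t) (h1 : t < τ (digit v w)) :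
    ∃ p b s, w = p ++ b :: s ∧ τ (digit v p) ≤ t ∧ t < τ (digit v p) + τ (v b) := by
  induction w generalizing t with
  | nil => simp [digit_nil] at h1; linarith
  | cons a w ih =>
    rcases lt_or_ge t (τ (v a)) with h | h
    · exact ⟨[], a, w, rfl, by simpa [digit_nil] using h0, by simpa [digit_nil] using h⟩
    · rw [digit_cons, map_add] at h1
      obtain ⟨p, b, s, rfl, hp, hb⟩ := ih (sub_nonneg.2 h) (by linarith)
      refine ⟨a :: p, b, s, rfl, ?_, ?_⟩ <;> rw [digit_cons, map_add] <;> linarith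

theorem approxIntegers_subset_span (hα : ∀ x ∈ Submodule.span ℤ (Set.range v),
    α * x ∈ Submodule.span ℤ (Set.range v)) (a : A) (k : ℕ) :
    approxIntegers σ α v a k ⊆ Submodule.span ℤ (Set.range v) := by
  rintro x ⟨c, p, -, -, rfl⟩
  refine sum_mem fun i _ => ?_
  induction i with
  | zero => simpa using digit_mem_span v (p 0)
  | succ i _ =>
    have key : ∀ (n : ℕ) (y : K), y ∈ Submodule.span ℤ (Set.range v) →
        y * α ^ n ∈ Submodule.span ℤ (Set.range v) := by
      intro n
      induction n with
      | zero => intro y hy; simpa using hy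
      | succ n ih => intro y hy; rw [pow_succ', ← mul_assoc, mul_comm y]; exact ih _ (hα _ hy)
    exact key _ _ (digit_mem_span v _)

theorem map_nonneg_of_mem_approxIntegers (hα : 0 ≤ τ α) (hv : ∀ a, 0 < τ (v a)) {a : A} {k : ℕ}
    {x : K} (hx : x ∈ approxIntegers σ α v a k) : 0 ≤ τ x := by
  obtain ⟨c, p, -, -, rfl⟩ := hx
  rw [map_sum]
  refine Finset.sum_nonneg fun i _ => ?_
  rw [map_mul, map_pow]
  exact mul_nonneg (map_digit_nonneg hv _) (pow_nonneg hα _)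

/-- An element of `ℤ_{σ,a}^{(k+1)}` that is too small for a non-trivial leading digit lies in
`ℤ_{σ,a}^{(k)}`. -/
theorem mem_approxIntegers_of_succ {δ : ℝ} (hδ : ∀ a, δ ≤ τ (v a)) (hα : 0 < τ α)
    (hv : ∀ a, 0 < τ (v a)) {a : A} {k : ℕ} {x : K} (hx : x ∈ approxIntegers σ α v a (k + 1))
    (hlt : τ x < δ * τ α ^ k) : x ∈ approxIntegers σ α v a k := by
  obtain ⟨c, p, h0, hc, rfl⟩ := hx
  have hx' : ∑ i ∈ Finset.range k, digit v (p i) * α ^ i ∈ approxIntegers σ α v a k :=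
    ⟨c, p, h0, fun i hi => hc i (by omega), rfl⟩
  rw [Finset.sum_range_succ] at hlt ⊢
  by_cases hp : p k = []
  · simpa [hp, digit_nil] using hx'
  · have h1 := map_nonneg_of_mem_approxIntegers hα.le hv hx'
    have h2 := mul_le_mul_of_nonneg_right (le_map_digit_of_ne_nil hδ hv hp) (pow_pos hα k).le
    rw [map_add, map_mul, map_pow] at hlt
    linarith

/-- As `α > 1`, the threshold `δ α^k` grows with `k`, so leading digits can be stripped one at a
time. Below a fixed height the sets thus decrease from some level on. -/
theorem mem_approxIntegers_of_le {δ : ℝ} (hδ0 : 0 < δ) (hδ : ∀ a, δ ≤ τ (v a)) (hα : 1 < τ α)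
    (hv : ∀ a, 0 < τ (v a)) {a : A} {k l : ℕ} (hkl : k ≤ l) {x : K}
    (hx : x ∈ approxIntegers σ α v a l) (hlt : τ x < δ * τ α ^ k) :
    x ∈ approxIntegers σ α v a k := by
  induction l, hkl using Nat.le_induction with
  | base => exact hx
  | succ l hl ih =>
    refine ih (mem_approxIntegers_of_succ hδ (by linarith) hv hx (hlt.trans_le ?_))
    exact mul_le_mul_of_nonneg_left (pow_le_pow_right₀ hα.le hl) hδ0.le

/-- Greedy algorithm: at scale `α^k` the image `σ(b)` tiles the interval of length `α^(k+1) δ(b)`.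
The letter whose block contains `t` gives the leading prefix, and the remainder is expanded inside
that block. -/
theorem exists_walk_of_lt [Fintype A] [DecidableEq A] (hα : 0 < τ α)
    (hv : Matrix.vecMul v (σ.incidence.map (fun m : ℕ => (m : K))) = α • v) (k : ℕ) (b : A) {t : ℝ}
    (h0 : 0 ≤ t) (h1 : t < τ α ^ k * τ (v b)) :
    ∃ (c : ℕ → A) (p : ℕ → List A), c k = b ∧
      (∀ i < k, σ.PrefixEdge (c (i + 1)) (p i) (c i)) ∧
      τ (∑ i ∈ Finset.range k, digit v (p i) * α ^ i) ≤ t ∧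
      t < τ (∑ i ∈ Finset.range k, digit v (p i) * α ^ i) + τ (v (c 0)) := by
  induction k generalizing b t with
  | zero => exact ⟨fun _ => b, fun _ => [], rfl, by simp, by simpa using h0, by simpa using h1⟩
  | succ k ih =>
    have hk := pow_pos hα k
    obtain ⟨q, d, s, hqs, hq, hd⟩ := exists_split_of_lt_digit (τ := τ) (v := v) (w := σ.img b)
      (t := t / τ α ^ k) (div_nonneg h0 hk.le) (by
        rw [digit_img hv, map_mul, div_lt_iff₀ hk]
        calc t < _ := h1
          _ = _ := by ring)
    rw [le_div_iff₀ hk] at hq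
    rw [div_lt_iff₀ hk] at hd
    obtain ⟨c, p, hc, he, h2, h3⟩ := ih d (t := t - τ (digit v q) * τ α ^ k) (by linarith)
      (by linarith)
    have hsum : ∑ i ∈ Finset.range (k + 1), digit v (Function.update p k q i) * α ^ i =
        (∑ i ∈ Finset.range k, digit v (p i) * α ^ i) + digit v q * α ^ k := by
      rw [Finset.sum_range_succ, Function.update_self]
      congr 1
      refine Finset.sum_congr rfl fun i hi => ?_
      rw [Function.update_of_ne (Finset.mem_range.1 hi).ne]
    refine ⟨Function.update c (k + 1) b, Function.update p k q, Function.update_self .., ?_, ?_, ?_⟩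
    · intro i hi
      rw [Function.update_of_ne hi.ne]
      rcases Nat.lt_succ_iff_lt_or_eq.1 hi with h | rfl
      · rw [Function.update_of_ne (by omega), Function.update_of_ne h.ne]
        exact he i h
      · rw [Function.update_self, Function.update_self, hc]
        exact ⟨s, hqs⟩
    · rw [hsum, map_add, map_mul, map_pow]; linarith
    · rw [hsum, map_add, map_mul, map_pow, Function.update_of_ne (by omega)]; linarith

theorem finite_approxIntegers [Finite A] (a : A) (k : ℕ) : (approxIntegers σ α v a k).Finite := by
  have hpre : {p : List A | ∃ b s, σ.img b = p ++ s}.Finite := by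
    have : {p : List A | ∃ b s, σ.img b = p ++ s} = ⋃ b, {p | p ∈ (σ.img b).inits} := by
      ext p
      simp only [Set.mem_ofPred_eq, Set.mem_iUnion, List.mem_inits, List.IsPrefix, eq_comm]
    rw [this]
    exact Set.finite_iUnion fun b => List.finite_toSet _
  have hfin := Set.Finite.pi' (ι := Fin k) (fun _ => hpre.image (digit v))
  refine (hfin.image fun f => ∑ i : Fin k, f i * α ^ (i : ℕ)).subset ?_
  rintro x ⟨c, p, -, hc, rfl⟩
  refine ⟨fun i => digit v (p i), fun i => ?_, ?_⟩
  · obtain ⟨s, hs⟩ := hc i i.2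
    exact ⟨p i, ⟨c (i + 1), c i :: s, hs⟩, rfl⟩
  · exact Fin.sum_univ_eq_sum_range (fun i => digit v (p i) * α ^ i) k

end Walks

/-! ### Existence of the topological limits in `ℝ` -/

section Limits

variable {A K : Type*} [Field K] {τ : K →+* ℝ} {σ : Substitution A} {α : K} {v : A → K}

theorem lowerTopLimit_subset_upperTopLimit {Y : Type*} [TopologicalSpace Y] (S : ℕ → Set Y) :
    lowerTopLimit S ⊆ upperTopLimit S :=
  fun _ hy U hU => (hy U hU).frequently

theorem exists_forall_le_map [Finite A] (hv : ∀ a, 0 < τ (v a)) :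
    ∃ δ : ℝ, 0 < δ ∧ ∀ a, δ ≤ τ (v a) := by
  rcases isEmpty_or_nonempty A with h | h
  · exact ⟨1, one_pos, fun a => h.elim a⟩
  · obtain ⟨a, ha⟩ := Finite.exists_min fun a => τ (v a)
    exact ⟨_, hv a, ha⟩

/-- A point of the upper limit is the image of a point that belongs to all the sets
`ℤ_{σ,a}^{(k)}` with large `k`. -/
theorem exists_eventually_mem_of_mem_upperTopLimit [Finite A] (hα : 1 < τ α)
    (hv : ∀ a, 0 < τ (v a)) {a : A} {y : ℝ}
    (hy : y ∈ upperTopLimit fun k => τ '' approxIntegers σ α v a k) :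
    ∃ x, τ x = y ∧ ∀ᶠ k in atTop, x ∈ approxIntegers σ α v a k := by
  obtain ⟨δ, hδ0, hδ⟩ := exists_forall_le_map hv
  obtain ⟨k, hk⟩ : ∃ k : ℕ, y + 1 < δ * τ α ^ k := by
    obtain ⟨k, hk⟩ := pow_unbounded_of_one_lt ((y + 1) / δ) hα
    exact ⟨k, by rwa [div_lt_iff₀' hδ0] at hk⟩
  have hfreq : ∀ U ∈ 𝓝 y, U ⊆ Set.Iio (y + 1) → ∃ x ∈ approxIntegers σ α v a k, τ x ∈ U := by
    intro U hU hlt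
    obtain ⟨l, hl, z, ⟨x, hx, rfl⟩, hxU⟩ := frequently_atTop.1 (hy U hU) k
    exact ⟨x, mem_approxIntegers_of_le hδ0 hδ hα hv hl hx ((hlt hxU).trans hk), hxU⟩
  -- Level `k` is a finite, hence closed, set, and it already contains all points of later levels
  -- below `y + 1`; a limit of such points belongs to it.
  have hmem : y ∈ τ '' approxIntegers σ α v a k := by
    by_contra hcon
    have hopen : (τ '' approxIntegers σ α v a k)ᶜ ∈ 𝓝 y :=
      ((finite_approxIntegers a k).image τ).isClosed.isOpen_compl.mem_nhds hcon
    obtain ⟨x, hx, hxU⟩ := hfreq _ (inter_mem hopen (Iio_mem_nhds (lt_add_one y)))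
      Set.inter_subset_right
    exact hxU.1 ⟨x, hx, rfl⟩
  obtain ⟨x, -, rfl⟩ := hmem
  refine ⟨x, rfl, ?_⟩
  filter_upwards [eventually_ge_atTop k] with l hl
  have hlow : τ x + 1 < δ * τ α ^ l :=
    hk.trans_le (mul_le_mul_of_nonneg_left (pow_le_pow_right₀ hα.le hl) hδ0.le)
  by_contra hcon
  have hopen : (τ '' approxIntegers σ α v a l)ᶜ ∈ 𝓝 (τ x) := by
    refine ((finite_approxIntegers a l).image τ).isClosed.isOpen_compl.mem_nhds ?_
    rintro ⟨z, hz, hzx⟩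
    exact hcon (τ.injective hzx ▸ hz)
  obtain ⟨m, hm, z, ⟨x', hx', rfl⟩, hxU⟩ := frequently_atTop.1
    (hy _ (inter_mem hopen (Iio_mem_nhds (lt_add_one (τ x))))) l
  exact hxU.1 ⟨x', mem_approxIntegers_of_le hδ0 hδ hα hv hm hx' (hxU.2.trans hlow), rfl⟩

theorem mem_sigmaIntegers_of_eventually {a : A} {x : K}
    (hx : ∀ᶠ k in atTop, x ∈ approxIntegers σ α v a k) : x ∈ sigmaIntegers τ σ α v a :=
  fun _ hU => hx.mono fun _ hk => ⟨τ x, ⟨x, hk, rfl⟩, mem_of_mem_nhds hU⟩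

theorem mem_sigmaIntegers_iff [Finite A] (hα : 1 < τ α) (hv : ∀ a, 0 < τ (v a)) {a : A} {x : K} :
    x ∈ sigmaIntegers τ σ α v a ↔ ∀ᶠ k in atTop, x ∈ approxIntegers σ α v a k := by
  refine ⟨fun hx => ?_, mem_sigmaIntegers_of_eventually⟩
  obtain ⟨x', h, hx'⟩ := exists_eventually_mem_of_mem_upperTopLimit hα hv
    (lowerTopLimit_subset_upperTopLimit _ hx)
  exact τ.injective h ▸ hx'

theorem isTopLimit_approxIntegers [Finite A] (hα : 1 < τ α) (hv : ∀ a, 0 < τ (v a)) (a : A) :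
    IsTopLimit (fun k => τ '' approxIntegers σ α v a k) (τ '' sigmaIntegers τ σ α v a) := by
  have h1 : upperTopLimit (fun k => τ '' approxIntegers σ α v a k) ⊆
      τ '' sigmaIntegers τ σ α v a := by
    intro y hy
    obtain ⟨x, rfl, hx⟩ := exists_eventually_mem_of_mem_upperTopLimit hα hv hy
    exact ⟨x, mem_sigmaIntegers_of_eventually hx, rfl⟩
  have h2 : τ '' sigmaIntegers τ σ α v a ⊆
      lowerTopLimit (fun k => τ '' approxIntegers σ α v a k) := by
    rintro _ ⟨x, hx, rfl⟩
    exact hx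
  have h3 := lowerTopLimit_subset_upperTopLimit fun k => τ '' approxIntegers σ α v a k
  exact ⟨(h3.trans h1).antisymm h2, h1.antisymm (h2.trans h3)⟩

/-- Every non-negative real number is the sum of a `(σ,a)`-integer and an element of `[0, δ(a))`,
for some letter `a`. -/
theorem exists_sigmaIntegers_le_lt [Fintype A] [DecidableEq A] (hα : 1 < τ α)
    (hv : Matrix.vecMul v (σ.incidence.map (fun m : ℕ => (m : K))) = α • v)
    (hv_pos : ∀ a, 0 < τ (v a)) {t : ℝ} (ht : 0 ≤ t) :
    ∃ a, ∃ y ∈ sigmaIntegers τ σ α v a, τ y ≤ t ∧ t < τ y + τ (v a) := by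
  -- Growth is used only to have a letter at which to start the walks.
  obtain ⟨b, -⟩ := σ.exists_growing
  obtain ⟨δ, hδ0, hδ⟩ := exists_forall_le_map hv_pos
  obtain ⟨k, hk⟩ : ∃ k : ℕ, t < δ * τ α ^ k := by
    obtain ⟨k, hk⟩ := pow_unbounded_of_one_lt (t / δ) hα
    exact ⟨k, by rwa [div_lt_iff₀' hδ0] at hk⟩
  have hex : ∀ l : ℕ, ∃ z : A × K, z.2 ∈ approxIntegers σ α v z.1 (k + l) ∧ τ z.2 ≤ t ∧
      t < τ z.2 + τ (v z.1) := by
    intro l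
    obtain ⟨c, p, -, hc, h1, h2⟩ := exists_walk_of_lt (τ := τ) (by linarith) hv (k + l) b ht (by
      have h1 := pow_le_pow_right₀ hα.le (Nat.le_add_right k l)
      have h2 := mul_le_mul_of_nonneg_left (hδ b) (pow_pos (one_pos.trans hα) (k + l)).le
      have h3 := mul_le_mul_of_nonneg_left h1 hδ0.le
      linarith)
    exact ⟨(c 0, _), ⟨c, p, rfl, hc, rfl⟩, h1, h2⟩
  choose z hz1 hz2 hz3 using hex
  have hfin : (Set.range z).Finite := by
    refine (Set.finite_iUnion fun a => (Set.finite_singleton a).prod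
      (finite_approxIntegers (σ := σ) (α := α) (v := v) a k)).subset ?_
    rintro _ ⟨l, rfl⟩
    exact Set.mem_iUnion.2 ⟨(z l).1, rfl, mem_approxIntegers_of_le hδ0 hδ hα hv_pos
      (Nat.le_add_right k l) (hz1 l) ((hz2 l).trans_lt hk)⟩
  have : Finite (Set.range z) := hfin
  -- The greedy result may vary with the length of the walk, but takes finitely many values. By
  -- pigeonhole one value recurs at arbitrarily high levels, and stripping leading digits puts it in
  -- all levels from `k` on.
  obtain ⟨⟨_, l₀, rfl⟩, hinf⟩ := Finite.exists_infinite_fiber (Set.rangeFactorization z)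
  refine ⟨(z l₀).1, (z l₀).2, mem_sigmaIntegers_of_eventually ?_, hz2 l₀, hz3 l₀⟩
  filter_upwards [eventually_ge_atTop k] with m hm
  rw [Set.infinite_coe_iff] at hinf
  obtain ⟨l, hl, hml⟩ := hinf.exists_gt m
  have hl' : z l = z l₀ := congrArg Subtype.val hl
  refine mem_approxIntegers_of_le hδ0 hδ hα hv_pos (show m ≤ k + l by omega) (hl' ▸ hz1 l)
    ((hz2 l₀).trans_lt (hk.trans_le ?_))
  exact mul_le_mul_of_nonneg_left (pow_le_pow_right₀ hα.le hm) hδ0.le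

end Limits

/-! ### The sup norm on the representation space -/

section Embedding

variable {K : Type*} [Field K] [NumberField K] {τ : K →+* ℝ} {α : K}

instance (τ : K →+* ℝ) : Fintype {w : InfinitePlace K // w ≠ mainPlace τ} := Fintype.ofFinite _

/-- The diagonal embedding as a ring homomorphism. -/
def diagHom (τ : K →+* ℝ) (α : K) : K →+* ReprSpace τ α :=
  RingHom.prod (RingHom.pi fun w => algebraMap K w.1.Completion)
    (RingHom.pi fun P => FinitePlace.embedding P.1)

theorem coe_diagHom (τ : K →+* ℝ) (α : K) : ⇑(diagHom τ α) = diagEmb τ α := rfl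

theorem norm_algebraMap_completion {K : Type*} [Field K] (w : InfinitePlace K) (x : K) :
    ‖algebraMap K w.Completion x‖ = w x :=
  InfinitePlace.Completion.norm_coe w _

variable [Fintype {P : HeightOneSpectrum (𝓞 K) // P.valuation K α < 1}]

/-- The norm of the product uses the unsquared absolute value at complex places;
`reprBall_subset_closedBall` relates it to the normalised one. -/
theorem norm_diagHom_le_iff {x : K} {C : ℝ} (hC : 0 ≤ C) : ‖diagHom τ α x‖ ≤ C ↔
    (∀ w : {w : InfinitePlace K // w ≠ mainPlace τ}, w.1 x ≤ C) ∧
      ∀ P : {P : HeightOneSpectrum (𝓞 K) // P.valuation K α < 1},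
        ‖FinitePlace.embedding P.1 x‖ ≤ C := by
  rw [Prod.norm_def, sup_le_iff, pi_norm_le_iff_of_nonneg hC, pi_norm_le_iff_of_nonneg hC]
  refine and_congr (forall_congr' fun w => ?_) Iff.rfl
  rw [← norm_algebraMap_completion]
  rfl

theorem norm_embedding_lt_one_iff (P : HeightOneSpectrum (𝓞 K)) (x : K) :
    ‖FinitePlace.embedding P x‖ < 1 ↔ P.valuation K x < 1 := by
  rw [FinitePlace.norm_embedding]
  exact_mod_cast WithZeroMulInt.toNNReal_lt_one_iff (HeightOneSpectrum.one_lt_absNorm_nnreal P)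

theorem norm_embedding_le_one_iff (P : HeightOneSpectrum (𝓞 K)) (x : K) :
    ‖FinitePlace.embedding P x‖ ≤ 1 ↔ P.valuation K x ≤ 1 := by
  rw [FinitePlace.norm_embedding]
  exact_mod_cast WithZeroMulInt.toNNReal_le_one_iff (HeightOneSpectrum.one_lt_absNorm_nnreal P)

theorem norm_diagHom_lt_one (hα : ∀ w : InfinitePlace K, w ≠ mainPlace τ → w α < 1) :
    ‖diagHom τ α α‖ < 1 := by
  rw [Prod.norm_def, sup_lt_iff, pi_norm_lt_iff one_pos, pi_norm_lt_iff one_pos]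
  refine ⟨fun w => ?_, fun P => (norm_embedding_lt_one_iff P.1 α).2 P.2⟩
  exact (norm_algebraMap_completion w.1 α).trans_lt (hα w.1 w.2)

end Embedding

/-! ### Contraction by a Pisot number -/

section Pisot

variable {K : Type*} [Field K] [NumberField K] {τ : K →+* ℝ} {α : K}

theorem eq_of_map_eq_of_adjoin_eq_top {F : Type*} [Field F] [CharZero F]
    (hK : IntermediateField.adjoin ℚ {α} = ⊤) {φ ψ : K →+* F} (h : φ α = ψ α) : φ = ψ := by
  ext x
  have hx : x ∈ IntermediateField.adjoin ℚ {α} := hK ▸ IntermediateField.mem_top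
  induction hx using IntermediateField.adjoin_induction with
  | mem x hx => rw [Set.mem_singleton_iff.1 hx, h]
  | algebraMap q => simp
  | add x y _ _ hx hy => rw [map_add, map_add, hx, hy]
  | inv x _ hx => rw [map_inv₀, map_inv₀, hx]
  | mul x y _ _ hx hy => rw [map_mul, map_mul, hx, hy]

theorem isIntegral_of_isPisotNumber {K : Type*} [Field K] {τ : K →+* ℝ} {α : K}
    (hα : IsPisotNumber (τ α)) : IsIntegral ℤ α :=
  (isIntegral_algHom_iff (τ.toIntAlgHom) τ.injective).1 hα.1

/-- A place sends `α` to a conjugate. If this conjugate were `τ α`, the embeddings would agree on `K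
= ℚ(α)` and the place would be `𝔭₁`. -/
theorem apply_lt_one_of_isPisotNumber (hK : IntermediateField.adjoin ℚ {α} = ⊤)
    (hα : IsPisotNumber (τ α)) (w : InfinitePlace K) (hw : w ≠ mainPlace τ) : w α < 1 := by
  rw [← InfinitePlace.norm_embedding_eq]
  refine hα.2.2 _ ?_ fun h => hw ?_
  · have h1 : minpoly ℚ (τ α) = minpoly ℚ α := minpoly.algHom_eq τ.toRatAlgHom τ.injective α
    rw [h1]
    have h2 := Polynomial.aeval_algHom_apply w.embedding.toRatAlgHom α (minpoly ℚ α)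
    rw [minpoly.aeval, map_zero] at h2
    exact h2
  · have h1 : w.embedding = Complex.ofRealHom.comp τ := eq_of_map_eq_of_adjoin_eq_top hK h
    rw [mainPlace, ← h1, InfinitePlace.mk_embedding]

theorem finite_dividing (hα : α ≠ 0) (hint : IsIntegral ℤ α) :
    Finite {P : HeightOneSpectrum (𝓞 K) // P.valuation K α < 1} := by
  obtain ⟨a, rfl⟩ : ∃ a : 𝓞 K, algebraMap (𝓞 K) K a = α := ⟨⟨α, hint⟩, rfl⟩
  have h0 : Ideal.span {a} ≠ 0 := by
    rw [Ne, Ideal.zero_eq_bot, Ideal.span_singleton_eq_bot]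
    rintro rfl
    simp at hα
  refine ((Ideal.finite_factors h0).subset fun P hP => ?_).to_subtype
  exact (P.valuation_lt_one_iff_dvd a).1 hP

end Pisot

/-! ### Stability of `V` and `V · ℤ[α⁻¹]` under multiplication -/

section Lattice

variable {A K : Type*} [Field K] {τ : K →+* ℝ} {σ : Substitution A} {α : K} {v : A → K}

theorem span_le_latticeModule (α : K) (v : A → K) :
    Submodule.span ℤ (Set.range v) ≤ latticeModule α v := fun x hx => by
  rw [← mul_one x]
  exact Submodule.mul_mem_mul hx (one_mem (Algebra.adjoin ℤ {α⁻¹}))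

theorem inv_mul_mem_latticeModule {x : K} (hx : x ∈ latticeModule α v) :
    α⁻¹ * x ∈ latticeModule α v := by
  refine Submodule.mul_induction_on hx (fun m hm n hn => ?_) fun x y hx hy => ?_
  · rw [mul_left_comm]
    exact Submodule.mul_mem_mul hm ((Algebra.adjoin ℤ {α⁻¹}).mul_mem (Algebra.self_mem_adjoin_singleton ℤ α⁻¹) hn)
  · rw [mul_add]; exact add_mem hx hy

theorem mul_mem_span [Fintype A] [DecidableEq A]
    (hv : Matrix.vecMul v (σ.incidence.map (fun m : ℕ => (m : K))) = α • v) {x : K}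
    (hx : x ∈ Submodule.span ℤ (Set.range v)) : α * x ∈ Submodule.span ℤ (Set.range v) := by
  induction hx using Submodule.span_induction with
  | mem x hx => obtain ⟨a, rfl⟩ := hx; rw [← digit_img hv]; exact digit_mem_span _ _
  | zero => rw [mul_zero]; exact zero_mem _
  | add x y _ _ hx hy => rw [mul_add]; exact add_mem hx hy
  | smul n x _ hx => rw [mul_smul_comm]; exact Submodule.smul_mem _ _ hx

theorem mul_mem_latticeModule
    (hα : ∀ x ∈ Submodule.span ℤ (Set.range v), α * x ∈ Submodule.span ℤ (Set.range v))
    {x : K} (hx : x ∈ latticeModule α v) : α * x ∈ latticeModule α v := by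
  refine Submodule.mul_induction_on hx (fun m hm n hn => ?_) fun x y hx hy => ?_
  · rw [← mul_assoc]
    exact Submodule.mul_mem_mul (hα m hm) hn
  · rw [mul_add]; exact add_mem hx hy

theorem pow_mul_mem {L : Submodule ℤ K} {β : K} (hβ : ∀ x ∈ L, β * x ∈ L) (k : ℕ) {x : K}
    (hx : x ∈ L) : β ^ k * x ∈ L := by
  induction k with
  | zero => simpa using hx
  | succ k ih => rw [pow_succ', mul_assoc]; exact hβ _ ih

end Lattice

/-! ### Boundedness in `K_σ` -/

section Bounded

variable {A K : Type*} [Fintype A] [Field K] [NumberField K] {τ : K →+* ℝ} {σ : Substitution A}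
  {α : K} {v : A → K} [Fintype {P : HeightOneSpectrum (𝓞 K) // P.valuation K α < 1}]

theorem exists_norm_digit_le (τ : K →+* ℝ) (σ : Substitution A) (α : K)
    [Fintype {P : HeightOneSpectrum (𝓞 K) // P.valuation K α < 1}] (v : A → K) :
    ∃ C : ℝ, 0 ≤ C ∧ ∀ a p b, σ.PrefixEdge a p b → ‖diagHom τ α (digit v p)‖ ≤ C := by
  have hfin : (⋃ a, {p | p ∈ (σ.img a).inits}).Finite :=
    Set.finite_iUnion fun a => List.finite_toSet _
  obtain ⟨C, hC⟩ := (hfin.image fun p => ‖diagHom τ α (digit v p)‖).bddAbove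
  refine ⟨max C 0, le_max_right _ _, fun a p b ⟨s, hs⟩ => le_max_of_le_left (hC ⟨p, ?_, rfl⟩)⟩
  exact Set.mem_iUnion.2 ⟨a, (List.mem_inits ..).2 ⟨b :: s, hs.symm⟩⟩

/-- The digits come from a finite set and `Φ'(α)` contracts, so a geometric series bounds all the
sums at once. -/
theorem exists_norm_approxIntegers_le (hα : ‖diagHom τ α α‖ < 1) :
    ∃ C : ℝ, 0 ≤ C ∧ ∀ a k, ∀ x ∈ approxIntegers σ α v a k, ‖diagHom τ α x‖ ≤ C := by
  obtain ⟨C, hC0, hC⟩ := exists_norm_digit_le τ σ α v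
  have hρ : 0 ≤ ‖diagHom τ α α‖ := norm_nonneg _
  refine ⟨C * (1 - ‖diagHom τ α α‖)⁻¹, mul_nonneg hC0 (inv_nonneg.2 (by linarith)), ?_⟩
  rintro a k _ ⟨c, p, -, hc, rfl⟩
  rw [map_sum]
  calc ‖∑ i ∈ Finset.range k, diagHom τ α (digit v (p i) * α ^ i)‖
      ≤ ∑ i ∈ Finset.range k, C * ‖diagHom τ α α‖ ^ i := by
        refine norm_sum_le_of_le _ fun i hi => ?_
        have h1 := hC _ _ _ (hc i (Finset.mem_range.1 hi))
        -- `norm_pow_le'` does not need `‖1‖ = 1` but requires a positive exponent; the exponents `m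
        -- + 1` further on have the same reason.
        rcases i.eq_zero_or_pos with rfl | hi0
        · simpa using h1
        rw [map_mul, map_pow]
        exact (norm_mul_le _ _).trans (mul_le_mul h1 (norm_pow_le' _ hi0) (norm_nonneg _) hC0)
    _ = C * ∑ i ∈ Finset.range k, ‖diagHom τ α α‖ ^ i := by rw [Finset.mul_sum]
    _ ≤ _ := mul_le_mul_of_nonneg_left (by
        rw [← tsum_geometric_of_lt_one hρ hα]
        exact (summable_geometric_of_lt_one hρ hα).sum_le_tsum _ fun i _ => pow_nonneg hρ i) hC0

end Bounded

/-! ### Discreteness of `V · ℤ[α⁻¹]` in `ℝ × K_σ` -/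

section Discrete

variable {A K : Type*} [Field K] [NumberField K] {τ : K →+* ℝ} {α : K} {v : A → K}

theorem exists_int_mul_isIntegral [Finite A] (v : A → K) :
    ∃ d : ℤ, d ≠ 0 ∧ ∀ x ∈ Submodule.span ℤ (Set.range v), IsIntegral ℤ ((d : K) * x) := by
  obtain ⟨y, hy, h⟩ := exists_integral_multiples ℤ ℚ (Set.finite_range v).toFinset
  refine ⟨y, hy, fun x hx => ?_⟩
  induction hx using Submodule.span_induction with
  | mem x hx => simpa using h x (by simpa using hx)
  | zero => rw [mul_zero]; exact isIntegral_zero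
  | add x y _ _ hx hy => rw [mul_add]; exact hx.add hy
  | smul n x _ hx => rw [mul_smul_comm]; exact hx.smul n

theorem valuation_le_one_of_isIntegral (P : HeightOneSpectrum (𝓞 K)) {x : K}
    (hx : IsIntegral ℤ x) : P.valuation K x ≤ 1 :=
  P.valuation_le_one (⟨x, hx⟩ : 𝓞 K)

theorem isIntegral_of_valuation_le_one {x : K}
    (hx : ∀ P : HeightOneSpectrum (𝓞 K), P.valuation K x ≤ 1) : IsIntegral ℤ x := by
  obtain ⟨y, rfl⟩ := HeightOneSpectrum.mem_integers_of_valuation_le_one K x hx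
  exact y.2

/-- Away from the primes dividing `α`, the element `α⁻¹` is a unit, so only the denominators of `V`
remain, and `d` clears them. -/
theorem valuation_mul_le_one_of_mem_latticeModule {d : ℤ}
    (hd : ∀ x ∈ Submodule.span ℤ (Set.range v), IsIntegral ℤ ((d : K) * x))
    {P : HeightOneSpectrum (𝓞 K)} (hP : P.valuation K α = 1) {x : K}
    (hx : x ∈ latticeModule α v) : P.valuation K (d * x) ≤ 1 := by
  refine Submodule.mul_induction_on hx (fun m hm n hn => ?_) fun x y hx hy => ?_
  · rw [← mul_assoc, map_mul]
    refine mul_le_one' (valuation_le_one_of_isIntegral P (hd m hm)) ?_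
    have : Algebra.adjoin ℤ {α⁻¹} ≤ subalgebraOfSubring (P.valuation K).integer :=
      Algebra.adjoin_le (by
        rw [Set.singleton_subset_iff]
        show P.valuation K α⁻¹ ≤ 1
        rw [map_inv₀, hP, inv_one])
    exact this hn
  · rw [mul_add]
    exact (Valuation.map_add _ _ _).trans (max_le hx hy)

/-- One multiplier `α^(m+1) d` makes all these elements algebraic integers: `d` works at primes not
dividing `α`, and the power of `α` absorbs the bounded denominators at the others. Their conjugates
are bounded, so there are finitely many. -/
theorem finite_latticeModule_inter [Finite A]
    [Fintype {P : HeightOneSpectrum (𝓞 K) // P.valuation K α < 1}]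
    (hα0 : α ≠ 0) (hint : IsIntegral ℤ α) (hα : ‖diagHom τ α α‖ < 1) (C : ℝ) :
    {x : K | x ∈ latticeModule α v ∧ |τ x| ≤ C ∧ ‖diagHom τ α x‖ ≤ C}.Finite := by
  obtain ⟨d, hd0, hd⟩ := exists_int_mul_isIntegral v
  obtain ⟨m, hm⟩ : ∃ m : ℕ, ‖diagHom τ α α‖ ^ (m + 1) * (‖diagHom τ α d‖ * C) ≤ 1 := by
    have h := ((tendsto_pow_atTop_nhds_zero_of_lt_one (norm_nonneg _) hα).comp
      (tendsto_add_atTop_nat 1)).mul_const (‖diagHom τ α d‖ * C)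
    rw [zero_mul] at h
    exact (h.eventually (ge_mem_nhds one_pos)).exists
  have hinj : Function.Injective fun x : K => α ^ (m + 1) * (d * x) := by
    intro x y h
    exact mul_left_cancel₀ (Int.cast_ne_zero.2 hd0) (mul_left_cancel₀ (pow_ne_zero _ hα0) h)
  -- The bound `1` serves the places other than `𝔭₁`, the second term `𝔭₁` itself.
  refine ((Embeddings.finite_of_norm_le K ℂ
    (max 1 (|τ α| ^ (m + 1) * (|(d : ℝ)| * C)))).preimage hinj.injOn).subset ?_
  rintro x ⟨hx, hτ, hnorm⟩
  have hC : 0 ≤ C := (abs_nonneg _).trans hτ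
  have hle : ‖diagHom τ α (α ^ (m + 1) * (d * x))‖ ≤ 1 := by
    rw [map_mul, map_mul, map_pow]
    refine ((norm_mul_le _ _).trans (mul_le_mul (norm_pow_le' _ m.succ_pos)
      ((norm_mul_le _ _).trans (mul_le_mul_of_nonneg_left hnorm (norm_nonneg _)))
      (norm_nonneg _) (by positivity))).trans hm
  rw [norm_diagHom_le_iff zero_le_one] at hle
  refine ⟨isIntegral_of_valuation_le_one fun P => ?_, fun φ => ?_⟩
  · by_cases hP : P.valuation K α < 1
    · exact (norm_embedding_le_one_iff P _).1 (hle.2 ⟨P, hP⟩)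
    · have h1 : P.valuation K α = 1 :=
        (valuation_le_one_of_isIntegral P hint).antisymm (not_lt.1 hP)
      rw [map_mul, map_pow, h1, one_pow, one_mul]
      exact valuation_mul_le_one_of_mem_latticeModule hd h1 hx
  · rw [← InfinitePlace.apply]
    by_cases hφ : InfinitePlace.mk φ = mainPlace τ
    · refine le_max_of_le_right ?_
      rw [hφ, mainPlace, InfinitePlace.apply]
      simp only [RingHom.comp_apply, Complex.ofRealHom_eq_coe, Complex.norm_real, map_mul, map_pow,
        map_intCast, norm_mul, norm_pow, Real.norm_eq_abs]
      gcongr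
      rw [← Complex.ofReal_intCast, Complex.norm_real, Real.norm_eq_abs]
    · exact le_max_of_le_left (hle.1 ⟨_, hφ⟩)

end Discrete

/-! ### `V` has full rank in `K` -/

section Commensurable

variable {A K : Type*} [Field K] [NumberField K] {α : K} {v : A → K}

/-- The elements with a non-zero integer multiple in `V` are stable under `ℚ[α] = K`, and `v a ≠ 0`
is one of them. -/
theorem exists_int_mul_mem_span (hK : IntermediateField.adjoin ℚ {α} = ⊤)
    (hα : ∀ x ∈ Submodule.span ℤ (Set.range v), α * x ∈ Submodule.span ℤ (Set.range v))
    {a : A} (ha : v a ≠ 0) (x : K) :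
    ∃ d : ℤ, d ≠ 0 ∧ (d : K) * x ∈ Submodule.span ℤ (Set.range v) := by
  have hsmul : ∀ (n : ℤ) {y : K}, y ∈ Submodule.span ℤ (Set.range v) →
      (n : K) * y ∈ Submodule.span ℤ (Set.range v) := fun n y hy => by
    rw [← zsmul_eq_mul]; exact Submodule.smul_mem _ _ hy
  have key : ∀ y ∈ Algebra.adjoin ℚ {α}, ∀ x : K,
      (∃ d : ℤ, d ≠ 0 ∧ (d : K) * x ∈ Submodule.span ℤ (Set.range v)) →
      ∃ d : ℤ, d ≠ 0 ∧ (d : K) * (y * x) ∈ Submodule.span ℤ (Set.range v) := by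
    intro y hy
    induction hy using Algebra.adjoin_induction with
    | mem y hy =>
      rintro x ⟨d, hd, hx⟩
      rw [Set.mem_singleton_iff.1 hy]
      exact ⟨d, hd, by rw [mul_left_comm]; exact hα _ hx⟩
    | algebraMap q =>
      rintro x ⟨d, hd, hx⟩
      refine ⟨d * q.den, mul_ne_zero hd (by exact_mod_cast q.den_ne_zero), ?_⟩
      have h : ((d * q.den : ℤ) : K) * (algebraMap ℚ K q * x) = (q.num : K) * (d * x) := by
        have h1 : (q.den : K) * (q : K) = q.num := by exact_mod_cast Rat.den_mul_eq_num q
        rw [eq_ratCast, ← h1]; push_cast; ring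
      rw [h]
      exact hsmul _ hx
    | add y z _ _ hy hz =>
      intro x hx
      obtain ⟨d, hd, h1⟩ := hy x hx
      obtain ⟨e, he, h2⟩ := hz x hx
      refine ⟨d * e, mul_ne_zero hd he, ?_⟩
      have h : ((d * e : ℤ) : K) * ((y + z) * x) = e * (d * (y * x)) + d * (e * (z * x)) := by
        push_cast; ring
      rw [h]
      exact add_mem (hsmul _ h1) (hsmul _ h2)
    | mul y z _ _ hy hz =>
      intro x hx
      rw [mul_assoc]
      exact hy _ (hz x hx)
  have htop : Algebra.adjoin ℚ {α} = ⊤ := by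
    rw [← IntermediateField.adjoin_simple_toSubalgebra_of_isAlgebraic
      (Algebra.IsAlgebraic.isAlgebraic α), hK, IntermediateField.top_toSubalgebra]
  obtain ⟨d, hd, h⟩ := key (x / v a) (htop ▸ Algebra.mem_top) (v a)
    ⟨1, one_ne_zero, by
      rw [Int.cast_one, one_mul]; exact Submodule.subset_span (Set.mem_range_self a)⟩
  exact ⟨d, hd, by rwa [div_mul_cancel₀ _ ha] at h⟩

theorem exists_int_mul_ringOfIntegers_mem_span (hK : IntermediateField.adjoin ℚ {α} = ⊤)
    (hα : ∀ x ∈ Submodule.span ℤ (Set.range v), α * x ∈ Submodule.span ℤ (Set.range v))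
    {a : A} (ha : v a ≠ 0) :
    ∃ d : ℤ, d ≠ 0 ∧ ∀ y : 𝓞 K, (d : K) * y ∈ Submodule.span ℤ (Set.range v) := by
  choose f hf0 hf using fun i => exists_int_mul_mem_span hK hα ha (RingOfIntegers.basis K i : K)
  refine ⟨∏ i, f i, Finset.prod_ne_zero_iff.2 fun i _ => hf0 i, fun y => ?_⟩
  rw [← (RingOfIntegers.basis K).sum_repr y, RingOfIntegers.coe_eq_algebraMap, map_sum,
    Finset.mul_sum]
  refine sum_mem fun i _ => ?_
  rw [← Finset.mul_prod_erase _ _ (Finset.mem_univ i), zsmul_eq_mul, map_mul, map_intCast]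
  have h := Submodule.smul_mem (Submodule.span ℤ (Set.range v))
    ((RingOfIntegers.basis K).repr y i * ∏ x ∈ Finset.univ.erase i, f x) (hf i)
  rw [zsmul_eq_mul] at h
  convert h using 1
  push_cast
  ring

end Commensurable

/-! ### Approximation by algebraic integers -/

section Approximation

variable {K : Type*} [Field K] [NumberField K]

theorem infinitePlace_ratCast {K : Type*} [Field K] [CharZero K] (w : InfinitePlace K) (q : ℚ) : w (q : K) = |(q : ℝ)| := by
  rw [← InfinitePlace.norm_embedding_eq, map_ratCast]
  simp

/-- Rounding the coordinates in an integral basis: every element of `K` is at a bounded distance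
from the ring of integers at all infinite places. -/
theorem exists_ringOfIntegers_sub_le (K : Type*) [Field K] [NumberField K] :
    ∃ C : ℝ, ∀ x : K, ∃ y : 𝓞 K, ∀ w : InfinitePlace K, w (y - x) ≤ C := by
  refine ⟨∑ w : InfinitePlace K, ∑ i, w (integralBasis K i), fun x => ?_⟩
  refine ⟨∑ i, ⌊(integralBasis K).repr x i⌋ • RingOfIntegers.basis K i, fun w => ?_⟩
  have hx : ((∑ i, ⌊(integralBasis K).repr x i⌋ • RingOfIntegers.basis K i : 𝓞 K) : K) - x =
      -∑ i, ((Int.fract ((integralBasis K).repr x i) : ℚ) : K) * integralBasis K i := by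
    have h := (integralBasis K).sum_repr x
    generalize (integralBasis K).repr x = c at h ⊢
    rw [← h, RingOfIntegers.coe_eq_algebraMap, map_sum, ← Finset.sum_sub_distrib,
      ← Finset.sum_neg_distrib]
    refine Finset.sum_congr rfl fun i _ => ?_
    rw [integralBasis_apply, zsmul_eq_mul, map_mul, map_intCast, Algebra.smul_def, Int.fract,
      eq_ratCast]
    push_cast
    ring
  rw [hx, ← InfinitePlace.norm_embedding_eq, map_neg, norm_neg, map_sum]
  refine (norm_sum_le _ _).trans ((Finset.sum_le_sum fun i _ => ?_).trans
    (Finset.single_le_sum (f := fun w : InfinitePlace K => ∑ i, w (integralBasis K i))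
      (fun w _ => Finset.sum_nonneg fun i _ => apply_nonneg w _) (Finset.mem_univ w)))
  rw [InfinitePlace.norm_embedding_eq, map_mul, infinitePlace_ratCast]
  refine mul_le_of_le_one_left (apply_nonneg w _) ?_
  rw [abs_of_nonneg (by exact_mod_cast Int.fract_nonneg _)]
  exact_mod_cast (Int.fract_lt_one _).le

/-- `K` is dense in the product of its infinite completions; an approximating element of `K` is then
rounded to `𝓞 K`. -/
theorem exists_ringOfIntegers_norm_sub_le (τ : K →+* ℝ) :
    ∃ C : ℝ, ∀ z : (w : {w : InfinitePlace K // w ≠ mainPlace τ}) → w.1.Completion,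
      ∃ y : 𝓞 K, ∀ w, ‖algebraMap K w.1.Completion (y : K) - z w‖ ≤ C := by
  classical
  obtain ⟨C, hC⟩ := exists_ringOfIntegers_sub_le K
  refine ⟨C + 1, fun z => ?_⟩
  -- The coordinate at `𝔭₁` is irrelevant and is set to `0`.
  let z' : (w : InfinitePlace K) → w.Completion :=
    fun w => if h : w ≠ mainPlace τ then z ⟨w, h⟩ else 0
  have hopen : IsOpen {y : (w : InfinitePlace K) → w.Completion | ∀ w, ‖y w - z' w‖ < 1} := by
    simp only [Set.ofPred_forall]
    exact isOpen_iInter_of_finite fun w => isOpen_lt (by fun_prop) continuous_const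
  obtain ⟨x, hx⟩ := (InfiniteAdeleRing.denseRange_algebraMap K).exists_mem_open hopen
    ⟨z', fun w => by simp⟩
  obtain ⟨y, hy⟩ := hC x
  refine ⟨y, fun w => ?_⟩
  have h1 : ‖algebraMap K w.1.Completion x - z w‖ < 1 := by
    have := hx w.1
    simp only [z', w.2, ne_eq, not_false_eq_true, dif_pos] at this
    exact this
  have h2 : ‖algebraMap K w.1.Completion ((y : K) - x)‖ ≤ C := by
    rw [norm_algebraMap_completion]; exact hy w.1
  rw [map_sub] at h2
  calc _ = ‖(algebraMap K w.1.Completion (y : K) - algebraMap K w.1.Completion x) +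
      (algebraMap K w.1.Completion x - z w)‖ := by rw [sub_add_sub_cancel]
    _ ≤ _ := (norm_add_le _ _).trans (by linarith)

theorem norm_embedding_le_norm_embedding {P : HeightOneSpectrum (𝓞 K)} {x y : K}
    (h : P.valuation K x ≤ P.valuation K y) :
    ‖FinitePlace.embedding P x‖ ≤ ‖FinitePlace.embedding P y‖ := by
  rw [FinitePlace.norm_embedding', FinitePlace.norm_embedding']
  exact_mod_cast (WithZeroMulInt.toNNReal_strictMono
    (HeightOneSpectrum.one_lt_absNorm_nnreal P)).monotone h

/-- With the ordinary triangle inequality, `1 / 2` leaves room for an element of `K` near `z` to be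
`P`-integral; it is then reduced modulo `a`. The two errors give the factor `2`. -/
theorem exists_ringOfIntegers_norm_embedding_sub_le (P : HeightOneSpectrum (𝓞 K)) {a : 𝓞 K}
    (ha : a ≠ 0) (z : P.adicCompletion K) (hz : ‖z‖ ≤ 1 / 2) :
    ∃ r : 𝓞 K, ‖FinitePlace.embedding P (r : K) - z‖ ≤ 2 * ‖FinitePlace.embedding P (a : K)‖ := by
  have haK : (a : K) ≠ 0 := by simpa using ha
  have hpos : 0 < ‖FinitePlace.embedding P (a : K)‖ := by simpa using haK
  obtain ⟨x, hx⟩ := (HeightOneSpectrum.denseRange_algebraMap K P).exists_mem_open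
    (Metric.isOpen_ball (x := z) (ε := min (1 / 2) ‖FinitePlace.embedding P (a : K)‖))
    ⟨z, Metric.mem_ball_self (lt_min (by norm_num) hpos)⟩
  have hx' : ‖FinitePlace.embedding P x - z‖ < min (1 / 2) ‖FinitePlace.embedding P (a : K)‖ := by
    rw [Metric.mem_ball, dist_eq_norm] at hx
    exact hx
  obtain ⟨hx1, hx2⟩ := lt_min_iff.1 hx'
  have hle : P.valuation K x ≤ 1 := by
    rw [← norm_embedding_le_one_iff]
    calc ‖FinitePlace.embedding P x‖ = ‖(FinitePlace.embedding P x - z) + z‖ := by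
          rw [sub_add_cancel]
      _ ≤ 1 := (norm_add_le _ _).trans (by linarith)
  obtain ⟨r, hr⟩ := P.exists_valuation_sub_lt_of_integer hle
    (Units.mk0 (P.valuation K (a : K)) ((Valuation.ne_zero_iff _).2 haK))
  have hr' := norm_embedding_le_norm_embedding (P := P) (x := (r : K) - x) (y := a) hr.le
  rw [map_sub] at hr'
  refine ⟨r, ?_⟩
  calc _ = ‖(FinitePlace.embedding P (r : K) - FinitePlace.embedding P x) +
      (FinitePlace.embedding P x - z)‖ := by rw [sub_add_sub_cancel]
    _ ≤ _ := (norm_add_le _ _).trans (by linarith)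

/-- Simultaneous approximation at finitely many finite places, up to a given element of the ring
of integers. -/
theorem exists_ringOfIntegers_forall_norm_sub_le {ι : Type*} [Fintype ι]
    {P : ι → HeightOneSpectrum (𝓞 K)} (hP : Function.Injective P) {a : 𝓞 K} (ha : a ≠ 0)
    (z : (i : ι) → (P i).adicCompletion K) (hz : ∀ i, ‖z i‖ ≤ 1 / 2) :
    ∃ y : 𝓞 K, ∀ i, ‖FinitePlace.embedding (P i) (y : K) - z i‖ ≤
      3 * ‖FinitePlace.embedding (P i) (a : K)‖ := by
  choose r hr using fun i => exists_ringOfIntegers_norm_embedding_sub_le (P i) ha (z i) (hz i)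
  have he : ∀ i, ∃ e : ℕ, (P i).intValuation a = WithZero.exp (-(e : ℤ)) := fun i =>
    ⟨_, (P i).intValuation_if_neg ha⟩
  choose e he using he
  -- Chinese remainder theorem, modulo the exact power of each `P i` in `a`.
  obtain ⟨y, hy⟩ := exists_forall_sub_mem_ideal (s := Finset.univ) (fun i => (P i).asIdeal) e
    (fun i _ => (P i).prime) (fun i _ j _ hij h => hij (hP (HeightOneSpectrum.ext h)))
    (fun i => r i)
  refine ⟨y, fun i => ?_⟩
  have h1 : (P i).valuation K ((y : K) - r i) ≤ (P i).valuation K (a : K) := by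
    have := ((P i).intValuation_le_pow_iff_mem _ _).2 (hy i (Finset.mem_univ i))
    rw [← he, ← HeightOneSpectrum.valuation_of_algebraMap (K := K),
      ← HeightOneSpectrum.valuation_of_algebraMap (K := K)] at this
    simpa using this
  have h2 := norm_embedding_le_norm_embedding h1
  rw [map_sub] at h2
  calc _ = ‖(FinitePlace.embedding (P i) (y : K) - FinitePlace.embedding (P i) (r i : K)) +
      (FinitePlace.embedding (P i) (r i : K) - z i)‖ := by rw [sub_add_sub_cancel]
    _ ≤ _ := (norm_add_le _ _).trans (by linarith [hr i])

/-- The target is multiplied by `α^m` until it is small, approximated modulo `α^m`, and divided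
back, so the error `3 ‖α^m‖` becomes `3`. -/
theorem exists_pow_mul_ringOfIntegers_norm_sub_le {α : K}
    [Fintype {P : HeightOneSpectrum (𝓞 K) // P.valuation K α < 1}] (hα0 : α ≠ 0)
    (hint : IsIntegral ℤ α)
    (z : (P : {P : HeightOneSpectrum (𝓞 K) // P.valuation K α < 1}) → P.1.adicCompletion K) :
    ∃ (m : ℕ) (y : 𝓞 K), ∀ P,
      ‖FinitePlace.embedding P.1 (α⁻¹ ^ m * (y : K)) - z P‖ ≤ 3 := by
  obtain ⟨a, rfl⟩ : ∃ a : 𝓞 K, algebraMap (𝓞 K) K a = α := ⟨⟨α, hint⟩, rfl⟩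
  have ha0 : a ≠ 0 := by rintro rfl; simp at hα0
  obtain ⟨m, hm⟩ : ∃ m : ℕ, ∀ P : {P : HeightOneSpectrum (𝓞 K) // P.valuation K (a : K) < 1},
      ‖FinitePlace.embedding P.1 (a : K)‖ ^ m * ‖z P‖ ≤ 1 / 2 := by
    refine (eventually_all.2 fun P => ?_ : ∀ᶠ m : ℕ in atTop, ∀ P, _).exists
    have h := (tendsto_pow_atTop_nhds_zero_of_lt_one (norm_nonneg _)
      ((norm_embedding_lt_one_iff P.1 _).2 P.2)).mul_const ‖z P‖
    rw [zero_mul] at h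
    exact h.eventually (ge_mem_nhds (by norm_num))
  obtain ⟨y, hy⟩ := exists_ringOfIntegers_forall_norm_sub_le
    (P := fun P : {P : HeightOneSpectrum (𝓞 K) // P.valuation K (a : K) < 1} => P.1)
    Subtype.val_injective (pow_ne_zero m ha0)
    (fun P => FinitePlace.embedding P.1 (a : K) ^ m * z P)
    (fun P => by rw [norm_mul, norm_pow]; exact hm P)
  refine ⟨m, y, fun P => ?_⟩
  have h0 : FinitePlace.embedding P.1 (a : K) ≠ 0 := by simpa using ha0
  have hpos : 0 < ‖FinitePlace.embedding P.1 (a : K) ^ m‖ := norm_pos_iff.2 (pow_ne_zero _ h0)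
  have h := hy P
  rw [RingOfIntegers.coe_eq_algebraMap (a ^ m), map_pow, map_pow] at h
  have heq : FinitePlace.embedding P.1 (a : K) ^ m *
      (FinitePlace.embedding P.1 ((a : K)⁻¹ ^ m * (y : K)) - z P) =
      FinitePlace.embedding P.1 (y : K) - FinitePlace.embedding P.1 (a : K) ^ m * z P := by
    rw [map_mul, map_pow, map_inv₀, mul_sub, ← mul_assoc, ← mul_pow, mul_inv_cancel₀ h0, one_pow,
      one_mul]
  rw [← heq, norm_mul, mul_comm (3 : ℝ)] at h
  exact le_of_mul_le_mul_left h hpos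

end Approximation

/-! ### Density of `V · ℤ[α⁻¹]` in `K_σ` -/

section Density

variable {A K : Type*} [Field K] [NumberField K] {τ : K →+* ℝ} {α : K} {v : A → K}
  [Fintype {P : HeightOneSpectrum (𝓞 K) // P.valuation K α < 1}]

theorem norm_embedding_intCast_le_one (P : HeightOneSpectrum (𝓞 K)) (d : ℤ) :
    ‖FinitePlace.embedding P (d : K)‖ ≤ 1 := by
  have := FinitePlace.norm_le_one K P (d : 𝓞 K)
  rwa [map_intCast] at this

/-- The term `α⁻¹ ^ m * (d * y)` settles the finite primes. The term `d * y'` then corrects the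
infinite ones and, being integral, costs at most `1` at the finite ones; hence `4 = 3 + 1`. -/
theorem exists_latticeModule_norm_sub_le (τ : K →+* ℝ)
    (hK : IntermediateField.adjoin ℚ {α} = ⊤) (hα0 : α ≠ 0) (hint : IsIntegral ℤ α)
    (hα : ∀ x ∈ Submodule.span ℤ (Set.range v), α * x ∈ Submodule.span ℤ (Set.range v))
    {a : A} (ha : v a ≠ 0) :
    ∃ C : ℝ, ∀ z : ReprSpace τ α, ∃ x ∈ latticeModule α v, ‖diagHom τ α x - z‖ ≤ C := by
  obtain ⟨d, hd0, hd⟩ := exists_int_mul_ringOfIntegers_mem_span hK hα ha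
  have hdK : (d : K) ≠ 0 := Int.cast_ne_zero.2 hd0
  obtain ⟨C, hC⟩ := exists_ringOfIntegers_norm_sub_le τ
  refine ⟨max 4 (|(d : ℝ)| * C), fun z => ?_⟩
  obtain ⟨m, y, hy⟩ := exists_pow_mul_ringOfIntegers_norm_sub_le hα0 hint
    fun P => (FinitePlace.embedding P.1 (d : K))⁻¹ * z.2 P
  obtain ⟨y', hy'⟩ := hC fun w => (algebraMap K w.1.Completion d)⁻¹ *
    (z.1 w - algebraMap K w.1.Completion (α⁻¹ ^ m * (d * y)))
  refine ⟨α⁻¹ ^ m * (d * y) + d * y', add_mem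
    (pow_mul_mem (fun _ => inv_mul_mem_latticeModule) m (span_le_latticeModule α v (hd y)))
    (span_le_latticeModule α v (hd y')), ?_⟩
  rw [Prod.norm_def, sup_le_iff, pi_norm_le_iff_of_nonneg (le_max_of_le_left (by norm_num)),
    pi_norm_le_iff_of_nonneg (le_max_of_le_left (by norm_num))]
  refine ⟨fun w => le_max_of_le_right ?_, fun P => le_max_of_le_left ?_⟩
  · have h0 : algebraMap K w.1.Completion d ≠ 0 := by
      rw [← norm_ne_zero_iff, norm_algebraMap_completion]
      exact (map_ne_zero w.1).2 hdK
    have hnorm : ‖algebraMap K w.1.Completion d‖ = |(d : ℝ)| := by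
      rw [norm_algebraMap_completion]
      exact_mod_cast infinitePlace_ratCast w.1 d
    have heq : algebraMap K w.1.Completion (α⁻¹ ^ m * (d * y) + d * y') - z.1 w =
        algebraMap K w.1.Completion d * (algebraMap K w.1.Completion (y' : K) -
          (algebraMap K w.1.Completion d)⁻¹ *
            (z.1 w - algebraMap K w.1.Completion (α⁻¹ ^ m * (d * y)))) := by
      rw [mul_sub, mul_inv_cancel_left₀ h0, RingHom.map_add, RingHom.map_mul _ (d : K) (y' : K)]
      ring
    change ‖algebraMap K w.1.Completion (α⁻¹ ^ m * (d * y) + d * y') - z.1 w‖ ≤ _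
    rw [heq, norm_mul, hnorm]
    exact mul_le_mul_of_nonneg_left (hy' w) (abs_nonneg _)
  · have h0 : FinitePlace.embedding P.1 (d : K) ≠ 0 := (map_ne_zero _).2 hdK
    have heq : FinitePlace.embedding P.1 (α⁻¹ ^ m * (d * y) + d * y') - z.2 P =
        FinitePlace.embedding P.1 (d : K) * (FinitePlace.embedding P.1 (α⁻¹ ^ m * (y : K)) -
          (FinitePlace.embedding P.1 (d : K))⁻¹ * z.2 P) +
        FinitePlace.embedding P.1 (d : K) * FinitePlace.embedding P.1 (y' : K) := by
      rw [mul_sub, mul_inv_cancel_left₀ h0, ← map_mul, ← map_mul, mul_left_comm, map_add]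
      ring
    change ‖FinitePlace.embedding P.1 (α⁻¹ ^ m * (d * y) + d * y') - z.2 P‖ ≤ _
    rw [heq]
    refine (norm_add_le _ _).trans ?_
    rw [norm_mul, norm_mul]
    have h1 := norm_embedding_intCast_le_one (K := K) P.1 d
    have h2 := mul_le_mul h1 (hy P) (norm_nonneg _) zero_le_one
    have h3 := mul_le_mul h1 (FinitePlace.norm_le_one K P.1 y') (norm_nonneg _) zero_le_one
    linarith

/-- Strong approximation: the non-negative elements of `V · ℤ[α⁻¹]` are dense in `K_σ`. -/
theorem exists_latticeModule_norm_sub_lt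
    (hK : IntermediateField.adjoin ℚ {α} = ⊤) (hα1 : 1 < τ α) (hint : IsIntegral ℤ α)
    (hρ : ‖diagHom τ α α‖ < 1)
    (hα : ∀ x ∈ Submodule.span ℤ (Set.range v), α * x ∈ Submodule.span ℤ (Set.range v))
    {a : A} (ha : 0 < τ (v a)) (z : ReprSpace τ α) {ε : ℝ} (hε : 0 < ε) :
    ∃ x ∈ latticeModule α v, 0 ≤ τ x ∧ ‖diagHom τ α x - z‖ < ε := by
  have hα0 : α ≠ 0 := by rintro rfl; simp at hα1; linarith
  have ha0 : v a ≠ 0 := by intro h; simp [h] at ha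
  obtain ⟨C, hC⟩ := exists_latticeModule_norm_sub_le τ hK hα0 hint hα ha0
  have hpow : ∀ B : ℝ, ∀ᶠ n : ℕ in atTop, ‖diagHom τ α α‖ ^ (n + 1) * B < ε / 2 := by
    intro B
    have h := ((tendsto_pow_atTop_nhds_zero_of_lt_one (norm_nonneg _) hρ).comp
      (tendsto_add_atTop_nat 1)).mul_const B
    rw [zero_mul] at h
    exact h.eventually (gt_mem_nhds (half_pos hε))
  obtain ⟨k, hk⟩ := (hpow C).exists
  -- Approximating the expanded target up to `C` and multiplying by `α^(k+1)` shrinks the error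
  -- below `ε / 2`.
  obtain ⟨x, hx, hxz⟩ := hC (diagHom τ α α⁻¹ ^ (k + 1) * z)
  -- Adding `α^(l+1) v a`, which is tiny in `K_σ` but huge in `ℝ`, makes the element non-negative.
  have hlarge : ∀ᶠ n : ℕ in atTop, -τ (α ^ (k + 1) * x) ≤ τ α ^ (n + 1) * τ (v a) :=
    (((tendsto_pow_atTop_atTop_of_one_lt hα1).comp (tendsto_add_atTop_nat 1)).atTop_mul_const
      ha).eventually_ge_atTop _
  obtain ⟨l, hl1, hl2⟩ := ((hpow ‖diagHom τ α (v a)‖).and hlarge).exists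
  have hmul : ∀ y ∈ latticeModule α v, α * y ∈ latticeModule α v :=
    fun y => mul_mem_latticeModule hα
  refine ⟨α ^ (k + 1) * x + α ^ (l + 1) * v a, add_mem (pow_mul_mem hmul _ hx)
    (pow_mul_mem hmul _ (span_le_latticeModule α v (Submodule.subset_span ⟨a, rfl⟩))), ?_, ?_⟩
  · rw [map_add, map_mul _ (α ^ (l + 1)), map_pow _ α (l + 1)]
    linarith
  · have hinv : diagHom τ α α ^ (k + 1) * diagHom τ α α⁻¹ ^ (k + 1) = 1 := by
      rw [← mul_pow, ← map_mul, mul_inv_cancel₀ hα0, map_one, one_pow]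
    have heq : diagHom τ α (α ^ (k + 1) * x + α ^ (l + 1) * v a) - z =
        diagHom τ α α ^ (k + 1) * (diagHom τ α x - diagHom τ α α⁻¹ ^ (k + 1) * z) +
          diagHom τ α α ^ (l + 1) * diagHom τ α (v a) := by
      rw [mul_sub, ← mul_assoc, hinv, one_mul, map_add, map_mul, map_mul, map_pow, map_pow]
      abel
    rw [heq]
    have hle : ∀ (n : ℕ) (y : ReprSpace τ α),
        ‖diagHom τ α α ^ (n + 1) * y‖ ≤ ‖diagHom τ α α‖ ^ (n + 1) * ‖y‖ := fun n y =>
      (norm_mul_le _ _).trans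
        (mul_le_mul_of_nonneg_right (norm_pow_le' _ n.succ_pos) (norm_nonneg _))
    have h1 := (hle k _).trans (mul_le_mul_of_nonneg_left hxz (by positivity))
    have h2 := hle l (diagHom τ α (v a))
    refine (norm_add_le _ _).trans_lt ?_
    linarith

end Density

/-! ### Local finiteness and covering -/

section Covering

variable {A K : Type*} [Fintype A] [Field K] [NumberField K] {τ : K →+* ℝ} {σ : Substitution A}
  {α : K} {v : A → K} [Fintype {P : HeightOneSpectrum (𝓞 K) // P.valuation K α < 1}]

/-- Where the norm is at least `1`, squaring only increases it; where it is smaller, the `1` in `max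
r 1` suffices. -/
theorem reprBall_subset_closedBall (c : ReprSpace τ α) (r : ℝ) :
    reprBall τ α c r ⊆ Metric.closedBall c (max r 1) := by
  intro z hz
  have h0 : 0 ≤ max r 1 := le_max_of_le_right zero_le_one
  rw [mem_closedBall_iff_norm, Prod.norm_def, sup_le_iff, pi_norm_le_iff_of_nonneg h0,
    pi_norm_le_iff_of_nonneg h0]
  refine ⟨fun w => ?_, fun P => le_max_of_le_left (hz.2 P)⟩
  rcases le_total ‖z.1 w - c.1 w‖ 1 with h | h
  · exact le_max_of_le_right h
  · exact le_max_of_le_left ((le_self_pow₀ h w.1.mult_ne_zero).trans (hz.1 w))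

theorem exists_norm_subtile_le (hα1 : 1 < τ α) (hv : ∀ a, 0 < τ (v a))
    (hρ : ‖diagHom τ α α‖ < 1) :
    ∃ C : ℝ, 0 ≤ C ∧ ∀ a, ∀ z ∈ subtile τ σ α v a, ‖z‖ ≤ C := by
  obtain ⟨C, hC0, hC⟩ := exists_norm_approxIntegers_le (σ := σ) (v := v) hρ
  refine ⟨C, hC0, fun a z hz => ?_⟩
  rw [← mem_closedBall_zero_iff]
  refine closure_minimal ?_ Metric.isClosed_closedBall hz
  rintro _ ⟨x, hx, rfl⟩
  obtain ⟨k, hk⟩ := ((mem_sigmaIntegers_iff hα1 hv).1 hx).exists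
  rw [mem_closedBall_zero_iff, ← coe_diagHom]
  exact hC a k x hk

/-- If the translates by `Φ'(x)` and `Φ'(x₀)` meet the same ball, then `x - x₀` is bounded both in
`ℝ` and in `K_σ`, so it lies in a finite set that does not depend on the centre. -/
theorem exists_encard_translatedSubtile_inter_le (hα1 : 1 < τ α) (hint : IsIntegral ℤ α)
    (hv : ∀ a, 0 < τ (v a)) (hρ : ‖diagHom τ α α‖ < 1) (R : ℝ) :
    ∃ m : ℕ, ∀ c : ReprSpace τ α, {g | g ∈ translationSet τ α v ∧
      (translatedSubtile τ σ α v g ∩ Metric.closedBall c R).Nonempty}.encard ≤ m := by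
  have hα0 : α ≠ 0 := by rintro rfl; simp at hα1; linarith
  obtain ⟨C, hC0, hC⟩ := exists_norm_subtile_le (σ := σ) hα1 hv hρ
  -- The first term bounds `Φ'(x - x₀)`; the sum exceeds the length of every interval `[0, δ(a))`.
  set B := max (2 * (R + C)) (∑ a, τ (v a))
  have hF := (finite_latticeModule_inter (v := v) hα0 hint hρ B).prod (Set.finite_univ (α := A))
  refine ⟨Set.ncard ({x : K | x ∈ latticeModule α v ∧ |τ x| ≤ B ∧ ‖diagHom τ α x‖ ≤ B} ×ˢ
    (Set.univ : Set A)), fun c => ?_⟩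
  rw [hF.cast_ncard_eq]
  have hdist : ∀ g x, g.1 = diagEmb τ α x →
      (translatedSubtile τ σ α v g ∩ Metric.closedBall c R).Nonempty →
      ‖diagHom τ α x - c‖ ≤ R + C := by
    rintro g x hg ⟨_, ⟨z, hz, rfl⟩, hzR⟩
    rw [hg, mem_closedBall_iff_norm, ← coe_diagHom] at hzR
    calc ‖diagHom τ α x - c‖ = ‖(z + diagHom τ α x - c) - z‖ := by congr 1; abel
      _ ≤ R + C := (norm_sub_le _ _).trans (add_le_add hzR (hC _ z hz))
  have hsum : ∀ a, τ (v a) ≤ B := fun a =>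
    le_max_of_le_right (Finset.single_le_sum (fun b _ => (hv b).le) (Finset.mem_univ a))
  rcases Set.eq_empty_or_nonempty {g | g ∈ translationSet τ α v ∧
    (translatedSubtile τ σ α v g ∩ Metric.closedBall c R).Nonempty} with h | ⟨g₀, hg₀, hne₀⟩
  · rw [h, Set.encard_empty]; exact zero_le
  obtain ⟨x₀, ⟨hx₀, hτ₀⟩, hgx₀⟩ := hg₀
  refine (Set.encard_le_encard ?_).trans (Set.encard_image_le
    (fun q : K × A => ((diagEmb τ α (x₀ + q.1), q.2) : ReprSpace τ α × A)) _)
  rintro g ⟨⟨x, ⟨hx, hτ⟩, hgx⟩, hne⟩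
  refine ⟨(x - x₀, g.2), ⟨⟨sub_mem hx hx₀, ?_, ?_⟩, Set.mem_univ _⟩, ?_⟩
  · have h1 := hsum g.2
    have h2 := hsum g₀.2
    rw [map_sub, abs_le]
    constructor <;> linarith [hτ.1, hτ.2, hτ₀.1, hτ₀.2]
  · refine le_max_of_le_left ?_
    have h1 := hdist g x hgx hne
    have h2 := hdist g₀ x₀ hgx₀ hne₀
    calc ‖diagHom τ α (x - x₀)‖ = ‖(diagHom τ α x - c) - (diagHom τ α x₀ - c)‖ := by
          rw [map_sub]; congr 1; abel
      _ ≤ _ := (norm_sub_le _ _).trans (by linarith)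
  · exact Prod.ext (by simp [hgx]) rfl

theorem uniformlyLocallyFinite_translatedSubtile (hα1 : 1 < τ α) (hint : IsIntegral ℤ α)
    (hv : ∀ a, 0 < τ (v a)) (hρ : ‖diagHom τ α α‖ < 1) :
    UniformlyLocallyFinite τ α (translationSet τ α v) (translatedSubtile τ σ α v) := by
  intro r
  obtain ⟨m, hm⟩ := exists_encard_translatedSubtile_inter_le (σ := σ) hα1 hint hv hρ (max r 1)
  refine ⟨m, fun c => (Set.encard_le_encard ?_).trans (hm c)⟩
  rintro g ⟨hg, hne⟩
  exact ⟨hg, hne.mono (Set.inter_subset_inter_right _ (reprBall_subset_closedBall c r))⟩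

theorem isClosed_iUnion_translatedSubtile (hα1 : 1 < τ α) (hint : IsIntegral ℤ α)
    (hv : ∀ a, 0 < τ (v a)) (hρ : ‖diagHom τ α α‖ < 1) :
    IsClosed (⋃ g ∈ translationSet τ α v, translatedSubtile τ σ α v g) := by
  rw [Set.biUnion_eq_iUnion]
  refine LocallyFinite.isClosed_iUnion (fun c => ?_) fun g => ?_
  · obtain ⟨m, hm⟩ := exists_encard_translatedSubtile_inter_le (σ := σ) hα1 hint hv hρ 1
    refine ⟨Metric.closedBall c 1, Metric.closedBall_mem_nhds c one_pos, ?_⟩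
    exact ((Set.finite_of_encard_le_coe (hm c)).preimage
      Subtype.val_injective.injOn).subset fun g hg => ⟨g.2, hg⟩
  · exact (Homeomorph.addRight g.1.1).isClosedMap _ isClosed_closure

/-- The greedy expansion gives a `(σ,a)`-integer `y ∈ V` with `x - y` in `[0, δ(a))`, so `x - y` is
a fractional part. -/
theorem diagEmb_mem_iUnion_translatedSubtile {A K : Type*} [Fintype A] [DecidableEq A] [Field K]
    [NumberField K] {τ : K →+* ℝ} {σ : Substitution A} {α : K} {v : A → K} (hα1 : 1 < τ α)
    (hv : Matrix.vecMul v (σ.incidence.map (fun m : ℕ => (m : K))) = α • v)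
    (hv_pos : ∀ a, 0 < τ (v a)) {x : K} (hx : x ∈ latticeModule α v) (h0 : 0 ≤ τ x) :
    diagEmb τ α x ∈ ⋃ g ∈ translationSet τ α v, translatedSubtile τ σ α v g := by
  obtain ⟨a, y, hy, h1, h2⟩ := exists_sigmaIntegers_le_lt hα1 hv hv_pos h0
  obtain ⟨k, hk⟩ := ((mem_sigmaIntegers_iff hα1 hv_pos).1 hy).exists
  have hyL : y ∈ latticeModule α v := span_le_latticeModule α v
    (approxIntegers_subset_span (fun _ => mul_mem_span hv) a k hk)
  refine Set.mem_biUnion (x := (diagEmb τ α (x - y), a)) ⟨x - y, ⟨sub_mem hx hyL, ?_⟩, rfl⟩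
    ⟨diagEmb τ α y, subset_closure ⟨y, hy, rfl⟩, ?_⟩
  · rw [map_sub]
    constructor <;> linarith
  · simp only [← coe_diagHom, map_sub]
    abel

end Covering

end

theorem mainTheorem5 {A : Type*} [Fintype A] [DecidableEq A]
    {K : Type*} [Field K] [NumberField K] (σ : Substitution A)
    (τ : K →+* ℝ) (α : K) (hK : IntermediateField.adjoin ℚ {α} = ⊤)
    (hσ : σ.IsIrreduciblePisot (τ α))
    (v : A → K)
    (hv : Matrix.vecMul v (σ.incidence.map (fun m : ℕ => (m : K))) = α • v)
    (hv_pos : ∀ a, 0 < τ (v a)) :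
    (∀ a, IsTopLimit (fun k => τ '' approxIntegers σ α v a k)
      (τ '' sigmaIntegers τ σ α v a)) ∧
    UniformlyLocallyFinite τ α (translationSet τ α v) (translatedSubtile τ σ α v) ∧
    ⋃ g ∈ translationSet τ α v, translatedSubtile τ σ α v g = Set.univ := by
  have hα1 : 1 < τ α := hσ.pisot.2.1
  have hα0 : α ≠ 0 := by rintro rfl; simp at hα1; linarith
  have hint : IsIntegral ℤ α := isIntegral_of_isPisotNumber hσ.pisot
  have := finite_dividing hα0 hint
  let _ := Fintype.ofFinite {P : HeightOneSpectrum (𝓞 K) // P.valuation K α < 1}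
  have hρ : ‖diagHom τ α α‖ < 1 :=
    norm_diagHom_lt_one (apply_lt_one_of_isPisotNumber hK hσ.pisot)
  obtain ⟨a, -⟩ := σ.exists_growing
  refine ⟨isTopLimit_approxIntegers hα1 hv_pos,
    uniformlyLocallyFinite_translatedSubtile hα1 hint hv_pos hρ, Set.eq_univ_of_forall fun z => ?_⟩
  -- The union is closed, so it suffices to find its points arbitrarily close to `z`.
  rw [← (isClosed_iUnion_translatedSubtile (σ := σ) hα1 hint hv_pos hρ).closure_eq,
    Metric.mem_closure_iff]
  intro ε hε
  obtain ⟨x, hx, h0, hxz⟩ := exists_latticeModule_norm_sub_lt hK hα1 hint hρ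
    (fun _ => mul_mem_span hv) (hv_pos a) z hε
  refine ⟨diagEmb τ α x, diagEmb_mem_iUnion_translatedSubtile hα1 hv hv_pos hx h0, ?_⟩
  rw [dist_comm, dist_eq_norm]
  exact hxz
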